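/- For a tuple $\mathcal X=(X_1,\dots,X_n)$ of subsets of $\mathbb R^2$ and a point $p\in\mathbb R^2$ let $\mathcal X[p]=\{i\in[n] : p\in X_i\}$ be the intersection pattern at $p$, and let $\operatorname{code}(\mathcal X)=\{\mathcal X[p] : p\in\mathbb R^2\}$. A set $P\subseteq\mathbb R^2$ is a set of representatives for $\mathcal X$ if $\operatorname{code}(\mathcal X)=\{\mathcal X[p] : p\in P\}$. Let $\mathcal X=(X_1,\dots,X_n)$ be a tuple of compact convex sets in $\mathbb R^2$ and let $P$ be a finite set of representatives for $\mathcal X$. Let $\mathcal Y=(Y_1,\dots,Y_n)$ be a tuple of compact convex sets in $\mathbb R^2$ such that 1. $Y_i\subseteq X_i$ for all $i\in[n]$, 2. $Y_i\cap P=X_i\cap P$ for all $i\in[n]$, 3. $\operatorname{code}(\mathcal Y)=\operatorname{code}(\mathcal X)$, and 4. $\mathcal Y$ is minimal, with respect to componentwise inclusion, among all tuples of compact convex sets satisfying 1, 2 and 3. Then each $Y_i$ is a polygon (possibly degenerate: a segment, a point, or empty), i.e. it is the convex hull of a finite set of points; equivalently, $Y_i$ has only finitely many extreme points. -/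

import Mathlib

namespace ConvexCode

/-- The intersection pattern of the tuple `X` at the point `p`. -/
def intersectionPattern {d n : ℕ} (X : Fin n → Set (EuclideanSpace ℝ (Fin d)))
    (p : EuclideanSpace ℝ (Fin d)) : Set (Fin n) :=
  {i | p ∈ X i}

/-- The code of the tuple `X`: the set of all its intersection patterns. -/
def code {d n : ℕ} (X : Fin n → Set (EuclideanSpace ℝ (Fin d))) : Set (Set (Fin n)) :=
  {c | ∃ p : EuclideanSpace ℝ (Fin d), intersectionPattern X p = c}

/-- `P` is a set of representatives for `X`: the patterns at points of `P` are exactly the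
elements of the code of `X`. -/
def IsSetOfRepresentatives {d n : ℕ} (X : Fin n → Set (EuclideanSpace ℝ (Fin d)))
    (P : Set (EuclideanSpace ℝ (Fin d))) : Prop :=
  code X = {c | ∃ p ∈ P, intersectionPattern X p = c}

/-- `Y` is a tuple of compact convex sets contained in the sets of `X`, containing the same points
of `P`, and realizing the same code. -/
structure IsReduction {d n : ℕ} (X : Fin n → Set (EuclideanSpace ℝ (Fin d)))
    (P : Set (EuclideanSpace ℝ (Fin d))) (Y : Fin n → Set (EuclideanSpace ℝ (Fin d))) : Prop where
  isCompact : ∀ i, IsCompact (Y i)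
  convex : ∀ i, Convex ℝ (Y i)
  subset : ∀ i, Y i ⊆ X i
  inter_eq : ∀ i, Y i ∩ P = X i ∩ P
  code_eq : code Y = code X

/-- `Y` is an inclusion-minimal realization of the code of `X` relative to `P`: it is minimal, for
componentwise inclusion, among the reductions of `X` relative to `P`. -/
def IsInclusionMinimalRealization {d n : ℕ} (X : Fin n → Set (EuclideanSpace ℝ (Fin d)))
    (P : Set (EuclideanSpace ℝ (Fin d))) (Y : Fin n → Set (EuclideanSpace ℝ (Fin d))) : Prop :=
  IsReduction X P Y ∧
    ∀ Z : Fin n → Set (EuclideanSpace ℝ (Fin d)),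
      IsReduction X P Z → (∀ i, Z i ⊆ Y i) → ∀ i, Z i = Y i

/-- A convex polygon in the plane, possibly degenerate (a segment, a point, or empty): the convex
hull of a finite set of points. -/
def IsPolygon (S : Set (EuclideanSpace ℝ (Fin 2))) : Prop :=
  ∃ F : Set (EuclideanSpace ℝ (Fin 2)), F.Finite ∧ S = convexHull ℝ F

end ConvexCode

open Filter Topology

namespace ConvexCode

/-! Infinitely many extreme points of `Y i` would accumulate at some `e` in the compact set `Y i`.
Around `e`, trim every set containing `e`: inside a small `ℓ¹` ball, keep only the segments from `e`
that reach the sphere. The trimmed tuple is still a reduction (`IsReduction.eventually_trimAt`):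
inside the punctured ball its pattern is that of `Y` at the radial projection to the sphere, so no
new pattern appears, and the points of `P` keep theirs, so none is lost. By minimality nothing was
trimmed; hence each point of `Y i` near `e`, other than `e`, is interior to a segment of `Y i` and
is not extreme. Krein–Milman then gives the polygon.

The delicate point is convexity of the trimmed sets. The `ℓ¹` norm is linear on each quadrant, which
settles each quadrant; the quadrants glue because for small radius nothing on the axes is trimmed.
-/

/-- The `ℓ¹` norm on the Euclidean plane. -/
def planeL1Norm (v : EuclideanSpace ℝ (Fin 2)) : ℝ := |v 0| + |v 1|

lemma planeL1Norm_smul (t : ℝ) (v : EuclideanSpace ℝ (Fin 2)) :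
    planeL1Norm (t • v) = |t| * planeL1Norm v := by
  simp [planeL1Norm, abs_mul, mul_add]

lemma norm_le_planeL1Norm (v : EuclideanSpace ℝ (Fin 2)) : ‖v‖ ≤ planeL1Norm v := by
  rw [EuclideanSpace.norm_eq, Fin.sum_univ_two, planeL1Norm]
  refine Real.sqrt_le_iff.2 ⟨by positivity, ?_⟩
  simp only [Real.norm_eq_abs]
  nlinarith [mul_nonneg (abs_nonneg (v 0)) (abs_nonneg (v 1))]

lemma planeL1Norm_pos {v : EuclideanSpace ℝ (Fin 2)} (hv : v ≠ 0) : 0 < planeL1Norm v :=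
  (norm_pos_iff.2 hv).trans_le (norm_le_planeL1Norm v)

lemma continuous_planeL1Norm : Continuous planeL1Norm := by
  unfold planeL1Norm
  fun_prop

/-- A set cut by a hyperplane is convex if both of its halves are, provided that it contains the
whole section of a convex superset. -/
lemma convex_of_convex_halves {E : Type*} [AddCommGroup E] [Module ℝ E] {K S : Set E}
    (f : E →ₗ[ℝ] ℝ) (hK : Convex ℝ K) (hSK : S ⊆ K) (hf : ∀ v ∈ K, f v = 0 → v ∈ S)
    (hpos : Convex ℝ {v ∈ S | 0 ≤ f v}) (hneg : Convex ℝ {v ∈ S | f v ≤ 0}) : Convex ℝ S := by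
  have key : ∀ a ∈ S, ∀ b ∈ S, f a < 0 → 0 < f b → segment ℝ a b ⊆ S := by
    intro a ha b hb hfa hfb
    have hd : 0 < f b - f a := by linarith
    -- The parameter at which the segment from `a` to `b` crosses the hyperplane.
    set s := -f a / (f b - f a) with hs_def
    have hs0 : 0 < s := div_pos (by linarith) hd
    have hs1 : 0 < 1 - s := sub_pos.2 ((div_lt_one hd).2 (by linarith))
    set c := (1 - s) • a + s • b with hc_def
    have hfc : f c = 0 := by
      simp only [hc_def, hs_def, map_add, map_smul, smul_eq_mul]
      field_simp
      ring
    have hcS : c ∈ S := hf c (hK (hSK ha) (hSK hb) hs1.le hs0.le (by ring)) hfc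
    rintro x ⟨u, t, hu, ht, hut, rfl⟩
    obtain rfl : u = 1 - t := by linarith
    have hx' : (1 - t) • a + t • b ∈ segment ℝ a c ∪ segment ℝ c b := by
      rcases le_total t s with h | h
      · refine .inl ⟨1 - t / s, t / s, sub_nonneg.2 ((div_le_one hs0).2 h), by positivity,
          by ring, ?_⟩
        rw [hc_def]
        match_scalars <;> field_simp <;> ring
      · refine .inr ⟨(1 - t) / (1 - s), (t - s) / (1 - s), by positivity,
          div_nonneg (by linarith) hs1.le, by field_simp; ring, ?_⟩
        rw [hc_def]
        match_scalars <;> field_simp <;> ring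
    rcases hx' with hx' | hx'
    · exact (hneg.segment_subset ⟨ha, hfa.le⟩ ⟨hcS, hfc.le⟩ hx').1
    · exact (hpos.segment_subset ⟨hcS, hfc.ge⟩ ⟨hb, hfb.le⟩ hx').1
  rw [convex_iff_segment_subset]
  intro a ha b hb
  rcases le_or_gt 0 (f a) with h1 | h1 <;> rcases le_or_gt 0 (f b) with h2 | h2
  · exact fun x hx => (hpos.segment_subset ⟨ha, h1⟩ ⟨hb, h2⟩ hx).1
  · rcases h1.eq_or_lt with h | h
    · exact fun x hx => (hneg.segment_subset ⟨ha, h.ge⟩ ⟨hb, h2.le⟩ hx).1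
    · rw [segment_symm]
      exact key b hb a ha h2 h
  · rcases h2.eq_or_lt with h | h
    · exact fun x hx => (hneg.segment_subset ⟨ha, h1.le⟩ ⟨hb, h.ge⟩ hx).1
    · exact key a ha b hb h1 h
  · exact fun x hx => (hneg.segment_subset ⟨ha, h1.le⟩ ⟨hb, h2.le⟩ hx).1

/-! ### Radial trimming of one convex set -/

/-- The union of the segments from `0` in `K` that reach the `ℓ¹` sphere of radius `r`. -/
def radialTrim (r : ℝ) (K : Set (EuclideanSpace ℝ (Fin 2))) : Set (EuclideanSpace ℝ (Fin 2)) :=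
  {v ∈ K | ∃ k ∈ K, r • v = planeL1Norm v • k}

lemma planeL1Norm_eq_of_signs {v : EuclideanSpace ℝ (Fin 2)} {s t : ℝ} (hs : |s| = 1)
    (ht : |t| = 1) (h0 : 0 ≤ s * v 0) (h1 : 0 ≤ t * v 1) :
    planeL1Norm v = s * v 0 + t * v 1 := by
  rw [← abs_of_nonneg h0, ← abs_of_nonneg h1, abs_mul, abs_mul, hs, ht, one_mul, one_mul,
    planeL1Norm]

lemma convex_radialTrim_quadrant {r : ℝ} {K : Set (EuclideanSpace ℝ (Fin 2))} (hK : Convex ℝ K)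
    {s t : ℝ} (hs : |s| = 1) (ht : |t| = 1) :
    Convex ℝ {v ∈ radialTrim r K | 0 ≤ s * v 0 ∧ 0 ≤ t * v 1} := by
  rintro a ⟨⟨haK, k, hk, hak⟩, ha0, ha1⟩ b ⟨⟨hbK, l, hl, hbl⟩, hb0, hb1⟩ x y hx hy hxy
  have hN (v : EuclideanSpace ℝ (Fin 2)) := planeL1Norm_eq_of_signs (v := v) hs ht
  have h0 : 0 ≤ s * (x • a + y • b) 0 := by
    have : s * (x • a + y • b) 0 = x * (s * a 0) + y * (s * b 0) := by simp; ring
    rw [this]; positivity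
  have h1 : 0 ≤ t * (x • a + y • b) 1 := by
    have : t * (x • a + y • b) 1 = x * (t * a 1) + y * (t * b 1) := by simp; ring
    rw [this]; positivity
  have hadd : planeL1Norm (x • a + y • b) = x * planeL1Norm a + y * planeL1Norm b := by
    rw [hN _ h0 h1, hN _ ha0 ha1, hN _ hb0 hb1]
    simp
    ring
  have hNa : 0 ≤ planeL1Norm a := (norm_nonneg a).trans (norm_le_planeL1Norm a)
  have hNb : 0 ≤ planeL1Norm b := (norm_nonneg b).trans (norm_le_planeL1Norm b)
  refine ⟨⟨hK haK hbK hx hy hxy, ?_⟩, h0, h1⟩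
  have hsum : r • (x • a + y • b) = (x * planeL1Norm a) • k + (y * planeL1Norm b) • l := by
    rw [smul_add, smul_comm r, smul_comm r, hak, hbl, smul_smul, smul_smul]
  rw [hsum, hadd]
  -- By convexity the weighted sum of `k` and `l` is the total weight times a point of `K`; by
  -- `hadd` that weight is the norm of the combination.
  obtain ⟨m, hm, hm'⟩ := hK.exists_mem_add_smul_eq hk hl (mul_nonneg hx hNa) (mul_nonneg hy hNb)
  exact ⟨m, hm, hm'.symm⟩

/-- If the segments of `K` along the coordinate axes that start at `0` reach the `ℓ¹` sphere of
radius `r`, then the radial trim of `K` is convex. -/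
lemma convex_radialTrim {r : ℝ} {K : Set (EuclideanSpace ℝ (Fin 2))} (hK : Convex ℝ K)
    (h0 : ∀ v ∈ K, v 0 = 0 → v ∈ radialTrim r K) (h1 : ∀ v ∈ K, v 1 = 0 → v ∈ radialTrim r K) :
    Convex ℝ (radialTrim r K) := by
  have half (s : ℝ) (hs : |s| = 1) : Convex ℝ {v ∈ radialTrim r K | 0 ≤ s * v 0} := by
    refine convex_of_convex_halves (K := {v ∈ K | 0 ≤ s * v 0})
      (EuclideanSpace.proj (𝕜 := ℝ) (ι := Fin 2) 1).toLinearMap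
      (hK.inter (convex_halfSpace_ge (f := fun v : EuclideanSpace ℝ (Fin 2) => s * v 0)
        ⟨fun x y => by simp [mul_add], fun c x => by simp; ring⟩ 0))
      (fun v hv => ⟨hv.1.1, hv.2⟩) (fun v hv hv1 => ⟨h1 v hv.1 (by simpa using hv1), hv.2⟩) ?_ ?_
    · refine (congrArg (Convex ℝ) (Set.ext fun v => ?_)).mpr
        (convex_radialTrim_quadrant (r := r) hK hs (t := 1) (by simp))
      simp [and_assoc]
    · refine (congrArg (Convex ℝ) (Set.ext fun v => ?_)).mpr
        (convex_radialTrim_quadrant (r := r) hK hs (t := -1) (by simp))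
      simp [and_assoc]
  refine convex_of_convex_halves
    (EuclideanSpace.proj (𝕜 := ℝ) (ι := Fin 2) 0).toLinearMap hK
    (fun v hv => hv.1) (fun v hv hv0 => h0 v hv (by simpa using hv0)) ?_ ?_
  · simpa using half 1 (by simp)
  · simpa using half (-1) (by simp)

lemma smul_mem_of_mem_radialTrim {r : ℝ} {K : Set (EuclideanSpace ℝ (Fin 2))}
    {v : EuclideanSpace ℝ (Fin 2)} (hv : v ≠ 0) (h : v ∈ radialTrim r K) :
    (r / planeL1Norm v) • v ∈ K := by
  obtain ⟨-, k, hk, h⟩ := h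
  rw [div_eq_inv_mul, mul_smul, h, inv_smul_smul₀ (planeL1Norm_pos hv).ne']
  exact hk

lemma mem_radialTrim_of_smul_mem {r : ℝ} {K : Set (EuclideanSpace ℝ (Fin 2))}
    {v : EuclideanSpace ℝ (Fin 2)} (hv : v ≠ 0) (hvK : v ∈ K)
    (h : (r / planeL1Norm v) • v ∈ K) : v ∈ radialTrim r K :=
  ⟨hvK, _, h, by rw [smul_smul, mul_div_cancel₀ _ (planeL1Norm_pos hv).ne']⟩

lemma zero_mem_radialTrim (r : ℝ) {K : Set (EuclideanSpace ℝ (Fin 2))}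
    (h0 : (0 : EuclideanSpace ℝ (Fin 2)) ∈ K) : 0 ∈ radialTrim r K :=
  ⟨h0, 0, h0, by simp⟩

lemma isClosed_radialTrim (r : ℝ) {K : Set (EuclideanSpace ℝ (Fin 2))}
    (hK : IsClosed K) (h0 : (0 : EuclideanSpace ℝ (Fin 2)) ∈ K) : IsClosed (radialTrim r K) := by
  refine isClosed_iff_frequently.2 fun v hv => ?_
  by_cases hv0 : v = 0
  · exact hv0 ▸ zero_mem_radialTrim r h0
  have hcont : ContinuousAt (fun w => (r / planeL1Norm w) • w) v :=
    (continuousAt_const.div continuous_planeL1Norm.continuousAt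
      (planeL1Norm_pos hv0).ne').smul continuousAt_id
  refine mem_radialTrim_of_smul_mem hv0
    (isClosed_iff_frequently.1 hK v (hv.mono fun w hw => hw.1))
    (hK.mem_of_frequently_of_tendsto ?_ hcont)
  exact (hv.and_eventually (isOpen_ne.mem_nhds hv0)).mono fun w hw =>
    smul_mem_of_mem_radialTrim hw.2 hw.1

/-- Inside the ball, membership depends only on the radial projection to the sphere; this is what
transfers patterns. -/
lemma mem_radialTrim_iff {r : ℝ} {K : Set (EuclideanSpace ℝ (Fin 2))} (hr : 0 < r)
    (hK : Convex ℝ K) (h0 : (0 : EuclideanSpace ℝ (Fin 2)) ∈ K)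
    {v : EuclideanSpace ℝ (Fin 2)} (hv : v ≠ 0) (hvr : planeL1Norm v ≤ r) :
    v ∈ radialTrim r K ↔ (r / planeL1Norm v) • v ∈ K := by
  have hN := planeL1Norm_pos hv
  refine ⟨smul_mem_of_mem_radialTrim hv, fun h => mem_radialTrim_of_smul_mem hv ?_ h⟩
  have := hK.smul_mem_of_zero_mem h0 h (t := planeL1Norm v / r)
    ⟨by positivity, (div_le_one hr).2 hvr⟩
  rwa [smul_smul, div_mul_div_cancel₀ hr.ne', div_self hN.ne', one_smul] at this

lemma mem_radialTrim_of_le {r : ℝ} {K : Set (EuclideanSpace ℝ (Fin 2))} (hr : 0 < r)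
    (hK : Convex ℝ K) (h0 : (0 : EuclideanSpace ℝ (Fin 2)) ∈ K)
    {v : EuclideanSpace ℝ (Fin 2)} (hvK : v ∈ K) (hv : r ≤ planeL1Norm v) :
    v ∈ radialTrim r K := by
  have hN := hr.trans_le hv
  exact ⟨hvK, _, hK.smul_mem_of_zero_mem h0 hvK ⟨by positivity, (div_le_one hN).2 hv⟩,
    by rw [smul_smul, mul_div_cancel₀ _ hN.ne']⟩

/-- A ray from `0` either meets `K` at most in `0` or has an initial segment in `K`. -/
lemma eventually_smul_mem {E : Type*} [AddCommGroup E] [Module ℝ E] {K : Set E}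
    (hK : Convex ℝ K) (h0 : (0 : E) ∈ K) (w : E) :
    ∀ᶠ r : ℝ in 𝓝[>] 0, ∀ t : ℝ, 0 < t → t • w ∈ K → r • w ∈ K := by
  by_cases h : ∃ t : ℝ, 0 < t ∧ t • w ∈ K
  · obtain ⟨t, ht, htK⟩ := h
    filter_upwards [Ioc_mem_nhdsGT ht] with r hr _ _ _
    have := hK.smul_mem_of_zero_mem h0 htK (t := r / t)
      ⟨div_nonneg hr.1.le ht.le, (div_le_one ht).2 hr.2⟩
    rwa [smul_smul, div_mul_cancel₀ _ ht.ne'] at this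
  · exact Eventually.of_forall fun r t ht htK => (h ⟨t, ht, htK⟩).elim

lemma eventually_mem_radialTrim_of_axis {K : Set (EuclideanSpace ℝ (Fin 2))}
    (hK : Convex ℝ K) (h0 : (0 : EuclideanSpace ℝ (Fin 2)) ∈ K)
    {w : EuclideanSpace ℝ (Fin 2)} (hw : planeL1Norm w = 1) :
    ∀ᶠ r : ℝ in 𝓝[>] 0, ∀ t : ℝ, t • w ∈ K → t • w ∈ radialTrim r K := by
  filter_upwards [eventually_smul_mem hK h0 w, eventually_smul_mem hK h0 (-w)] with r h1 h2 t ht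
  rcases lt_trichotomy t 0 with h | rfl | h
  · refine ⟨ht, _, h2 (-t) (by linarith) (by simpa using ht), ?_⟩
    rw [planeL1Norm_smul, hw, abs_of_neg h]
    module
  · simpa using zero_mem_radialTrim r h0
  · refine ⟨ht, _, h1 t h ht, ?_⟩
    rw [planeL1Norm_smul, hw, abs_of_pos h]
    module

lemma eventually_convex_radialTrim {K : Set (EuclideanSpace ℝ (Fin 2))}
    (hK : Convex ℝ K) (h0 : (0 : EuclideanSpace ℝ (Fin 2)) ∈ K) :
    ∀ᶠ r : ℝ in 𝓝[>] 0, Convex ℝ (radialTrim r K) := by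
  filter_upwards [eventually_mem_radialTrim_of_axis hK h0 (w := !₂[1, 0]) (by simp [planeL1Norm]),
    eventually_mem_radialTrim_of_axis hK h0 (w := !₂[0, 1]) (by simp [planeL1Norm])] with r hr hr'
  refine convex_radialTrim hK (fun v hv h => ?_) (fun v hv h => ?_)
  · have : v = v 1 • !₂[0, 1] := by
      ext i; fin_cases i <;> simp [h]
    rw [this] at hv ⊢
    exact hr' _ hv
  · have : v = v 0 • !₂[1, 0] := by
      ext i; fin_cases i <;> simp [h]
    rw [this] at hv ⊢
    exact hr _ hv

/-! ### Trimming a tuple at a point -/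

/-- Trimming all the sets of `Y` that contain `e` radially around `e`. -/
def trimAt {n : ℕ} (e : EuclideanSpace ℝ (Fin 2)) (r : ℝ)
    (Y : Fin n → Set (EuclideanSpace ℝ (Fin 2))) (i : Fin n) : Set (EuclideanSpace ℝ (Fin 2)) :=
  {q ∈ Y i | e ∈ Y i → q - e ∈ radialTrim r ((· + e) ⁻¹' Y i)}

lemma trimAt_of_mem {n : ℕ} {e : EuclideanSpace ℝ (Fin 2)} {r : ℝ}
    {Y : Fin n → Set (EuclideanSpace ℝ (Fin 2))} {i : Fin n} (h : e ∈ Y i) :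
    trimAt e r Y i = (· - e) ⁻¹' radialTrim r ((· + e) ⁻¹' Y i) := by
  ext q
  simp only [trimAt, Set.mem_ofPred_eq, h, true_implies, Set.mem_preimage, and_iff_right_iff_imp]
  intro hq
  simpa using hq.1

lemma trimAt_of_notMem {n : ℕ} {e : EuclideanSpace ℝ (Fin 2)} {r : ℝ}
    {Y : Fin n → Set (EuclideanSpace ℝ (Fin 2))} {i : Fin n} (h : e ∉ Y i) :
    trimAt e r Y i = Y i := by
  simp [trimAt, h]

/-- Trimming by a small radius preserves reductions. -/
lemma IsReduction.eventually_trimAt {n : ℕ} {X Y : Fin n → Set (EuclideanSpace ℝ (Fin 2))}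
    {P : Set (EuclideanSpace ℝ (Fin 2))} (hPfinite : P.Finite)
    (hP : IsSetOfRepresentatives X P) (hY : IsReduction X P Y) (e : EuclideanSpace ℝ (Fin 2)) :
    ∀ᶠ r : ℝ in 𝓝[>] 0, IsReduction X P (trimAt e r Y) := by
  have hconv (i : Fin n) : Convex ℝ ((· + e) ⁻¹' Y i) := (hY.convex i).translate_preimage_left e
  have hev1 : ∀ᶠ r : ℝ in 𝓝[>] 0, ∀ i, e ∈ Y i → Convex ℝ (radialTrim r ((· + e) ⁻¹' Y i)) := by
    refine eventually_all.2 fun i => ?_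
    by_cases h : e ∈ Y i
    · filter_upwards [eventually_convex_radialTrim (hconv i) (by simpa using h)] with r hr _
      exact hr
    · simp [h]
  -- Sets missing `e` are closed, so they miss a whole small ball and need no trimming.
  have hev2 : ∀ᶠ r : ℝ in 𝓝[>] 0, ∀ i, e ∉ Y i → ∀ v, planeL1Norm v ≤ r → v + e ∉ Y i := by
    refine eventually_all.2 fun i => ?_
    by_cases h : e ∈ Y i
    · simp [h]
    · obtain ⟨ε, hε, hball⟩ := Metric.isOpen_iff.1 (hY.isCompact i).isClosed.isOpen_compl e h
      filter_upwards [Ioo_mem_nhdsGT hε] with r hr _ v hv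
      refine hball ?_
      simpa using ((norm_le_planeL1Norm v).trans hv).trans_lt hr.2
  have hev3 : ∀ᶠ r : ℝ in 𝓝[>] 0, ∀ p ∈ P, p ≠ e → r ≤ planeL1Norm (p - e) := by
    refine (eventually_all_finite hPfinite).2 fun p _ => ?_
    by_cases h : p = e
    · simp [h]
    · filter_upwards [Ioc_mem_nhdsGT (planeL1Norm_pos (sub_ne_zero.2 h))] with r hr _
      exact hr.2
  filter_upwards [hev1, hev2, hev3, self_mem_nhdsWithin] with r h1 h2 h3 hr
  replace hr : 0 < r := hr
  have hfar (i : Fin n) (q : EuclideanSpace ℝ (Fin 2)) (hq : q = e ∨ r ≤ planeL1Norm (q - e)) :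
      q ∈ trimAt e r Y i ↔ q ∈ Y i := by
    refine ⟨fun h => h.1, fun h => ⟨h, fun he => ?_⟩⟩
    rcases hq with rfl | hq
    · rw [sub_self]
      exact zero_mem_radialTrim r (by simpa using he)
    · exact mem_radialTrim_of_le hr (hconv i) (by simpa using he) (by simpa using h) hq
  have hinter (i : Fin n) : trimAt e r Y i ∩ P = X i ∩ P := by
    rw [← hY.inter_eq i]
    ext p
    refine and_congr_left fun hp => hfar i p ?_
    by_cases h : p = e
    · exact .inl h
    · exact .inr (h3 p hp h)
  refine ⟨fun i => ?_, fun i => ?_, fun i q hq => hY.subset i hq.1, hinter, ?_⟩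
  · by_cases h : e ∈ Y i
    · refine (hY.isCompact i).of_isClosed_subset ?_ fun q hq => hq.1
      rw [trimAt_of_mem h]
      exact (isClosed_radialTrim r ((hY.isCompact i).isClosed.preimage (by fun_prop))
        (by simpa using h)).preimage (by fun_prop)
    · rw [trimAt_of_notMem h]
      exact hY.isCompact i
  · by_cases h : e ∈ Y i
    · rw [trimAt_of_mem h]
      simpa only [sub_eq_add_neg] using (h1 i h).translate_preimage_left (-e)
    · rw [trimAt_of_notMem h]
      exact hY.convex i
  · apply Set.Subset.antisymm
    · rw [← hY.code_eq]
      rintro _ ⟨q, rfl⟩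
      by_cases hq : q = e ∨ r ≤ planeL1Norm (q - e)
      · exact ⟨q, Set.ext fun i => (hfar i q hq).symm⟩
      · push Not at hq
        have hqe : q - e ≠ 0 := sub_ne_zero.2 hq.1
        have hN := planeL1Norm_pos hqe
        -- The radial projection of `q` to the sphere around `e`.
        refine ⟨(r / planeL1Norm (q - e)) • (q - e) + e, Set.ext fun i => ?_⟩
        change _ ∈ Y i ↔ q ∈ trimAt e r Y i
        by_cases h : e ∈ Y i
        · rw [trimAt_of_mem h]
          exact (mem_radialTrim_iff hr (hconv i) (by simpa using h) hqe hq.2.le).symm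
        · rw [trimAt_of_notMem h]
          refine iff_of_false (h2 i h _ ?_) fun hqY => h2 i h (q - e) hq.2.le (by simpa using hqY)
          rw [planeL1Norm_smul, abs_of_pos (by positivity), div_mul_cancel₀ _ hN.ne']
    · rw [show code X = _ from hP]
      rintro _ ⟨p, hp, rfl⟩
      refine ⟨p, Set.ext fun i => ?_⟩
      have := Set.ext_iff.1 (hinter i) p
      change p ∈ trimAt e r Y i ↔ p ∈ X i
      simpa [hp] using this

/-- The extreme points of the sets of a minimal realization are isolated. -/
lemma IsInclusionMinimalRealization.eventually_notMem_extremePoints {n : ℕ}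
    {X Y : Fin n → Set (EuclideanSpace ℝ (Fin 2))}
    {P : Set (EuclideanSpace ℝ (Fin 2))} (hPfinite : P.Finite)
    (hP : IsSetOfRepresentatives X P) (hY : IsInclusionMinimalRealization X P Y) (i : Fin n)
    {e : EuclideanSpace ℝ (Fin 2)} (he : e ∈ Y i) :
    ∀ᶠ q in 𝓝[≠] e, q ∉ Set.extremePoints ℝ (Y i) := by
  obtain ⟨r, hr, hr0⟩ :=
    ((hY.1.eventually_trimAt hPfinite hP e).and self_mem_nhdsWithin).exists
  replace hr0 : 0 < r := hr0
  have heq := hY.2 _ hr (fun j q hq => hq.1) i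
  have hcont : Continuous fun q => planeL1Norm (q - e) :=
    continuous_planeL1Norm.comp (continuous_id.sub continuous_const)
  have hnear : ∀ᶠ q in 𝓝[≠] e, planeL1Norm (q - e) < r :=
    (hcont.continuousAt.eventually_lt_const (by simpa [planeL1Norm] using hr0)).filter_mono
      nhdsWithin_le_nhds
  filter_upwards [hnear, self_mem_nhdsWithin] with q hq hqe hext
  have hqe' : q - e ≠ 0 := sub_ne_zero.2 hqe
  have hN := planeL1Norm_pos hqe'
  have hqY : q ∈ trimAt e r Y i := heq ▸ hext.1
  rw [trimAt_of_mem he] at hqY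
  have hk := (mem_radialTrim_iff hr0 ((hY.1.convex i).translate_preimage_left e)
    (by simpa using he) hqe' hq.le).1 hqY
  -- `q` lies strictly between `e` and its projection, both in `Y i`, so extremality would force `q
  -- = e`.
  refine hqe (hext.2 he hk ?_).symm
  refine ⟨1 - planeL1Norm (q - e) / r, planeL1Norm (q - e) / r,
    sub_pos.2 ((div_lt_one hr0).2 hq), by positivity, by ring, ?_⟩
  rw [smul_add, smul_smul, div_mul_div_cancel₀ hr0.ne', div_self hN.ne']
  module

end ConvexCode

theorem mainTheorem2 {n : ℕ} (X : Fin n → Set (EuclideanSpace ℝ (Fin 2)))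
    (hXcompact : ∀ i, IsCompact (X i)) (hXconvex : ∀ i, Convex ℝ (X i))
    (P : Set (EuclideanSpace ℝ (Fin 2))) (hPfinite : P.Finite)
    (hP : ConvexCode.IsSetOfRepresentatives X P)
    (Y : Fin n → Set (EuclideanSpace ℝ (Fin 2)))
    (hY : ConvexCode.IsInclusionMinimalRealization X P Y) :
    ∀ i, ConvexCode.IsPolygon (Y i) ∧ (Set.extremePoints ℝ (Y i)).Finite := by
  intro i
  have hfin : (Set.extremePoints ℝ (Y i)).Finite := by
    by_contra hinf
    obtain ⟨e, he, hacc⟩ := Set.Infinite.exists_accPt_of_subset_isCompact hinf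
      (hY.1.isCompact i) extremePoints_subset
    rw [accPt_iff_frequently_nhdsNE] at hacc
    exact hacc (hY.eventually_notMem_extremePoints hPfinite hP i he)
  refine ⟨⟨_, hfin, ?_⟩, hfin⟩
  rw [← (hfin.isCompact_convexHull ℝ).isClosed.closure_eq,
    closure_convexHull_extremePoints (hY.1.isCompact i) (hY.1.convex i)]
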